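/- Fix countably infinite, pairwise disjoint sets of individual names, concept names $A$ and role names $r$. $\mathcal{ALC}$-concepts are given by $C,D ::= \top \mid A \mid \neg C \mid C\sqcap D \mid \exists r.C$ with the usual semantics over interpretations $\mathcal I$ with arbitrary non-empty domain; an $\mathcal{ALC}$-TBox is a finite set of inclusions $C\sqsubseteq D$, and $\mathcal I$ is a model of it if $C^{\mathcal I}\subseteq D^{\mathcal I}$ for each of them. A *letter* is a role name $r$, an inverse $r^-$ of a role name, or a test $A?$ for a concept name $A$. Let the role names and their inverses be partitioned into call, internal and return letters; all tests are internal letters. A *visibly pushdown automaton* (VPA) is a nondeterministic pushdown automaton with finitely many states, stack symbols and transitions, reading words over the letters from an initial state with only the bottom symbol on the stack, that pushes one symbol on every call letter, pops one symbol on every return letter (the bottom symbol is read but not removed), leaves the stack unchanged on every internal letter, and accepts by final states. A word $w_1\dots w_n$ labels a path $d_1,\dots,d_{n+1}$ of $\mathcal I$ if for all $i\le n$: $(d_i,d_{i+1})\in r^{\mathcal I}$ when $w_i=r$; $(d_{i+1},d_i)\in r^{\mathcal I}$ when $w_i=r^-$; $d_i=d_{i+1}\in A^{\mathcal I}$ when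 $w_i=A?$. An element $d$ *$L$-reaches* $e$ if some path from $d$ to $e$ is labelled by a word of $L$. A *two-way visibly pushdown path query* (2VPQ) is a single atom $L(x,y)$ with variables $x,y$ and $L$ the language of a VPA, by which it is presented; $\mathcal I$ satisfies it if some assignment $\eta$ of elements to variables is such that $\eta(x)$ $L$-reaches $\eta(y)$. A TBox $\mathcal T$ entails a query $q$ if every model of $\mathcal T$ satisfies $q$. The concepts of $\mathcal{ALC}_{\mathsf{vpl}}$ with inverses are built with the constructors of $\mathcal{ALC}$, with $\exists r^-.C$, and with $\exists L.C$ for $L$ presented by a VPA over the letters above; $\exists L.C$ holds at the elements that $L$-reach an element of $C$. A concept is satisfiable if its extension is non-empty in some interpretation. **Theorem.** 1. The entailment problem of 2VPQs over $\mathcal{ALC}$-TBoxes (given an $\mathcal{ALC}$-TBox $\mathcal T$ and a 2VPQ $q$, does $\mathcal T$ entail $q$?) is undecidable. 2. The concept satisfiability problem for $\mathcal{ALC}_{\mathsf{vpl}}$ with inverses is undecidable. Both hold when the partition into call, internal and return letters is part of the input (given by its finite sets of call and of return letters). Both also hold for every fixed partition for which there are role names $r$ and $s$ such that $s$ is a return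 letter, $s^-$ is a call letter and $r$ is an internal letter. -/

import Mathlib

namespace TwoWayVPQ

/-! ## Roles and letters

Concept names, role names, individual names and query variables are four separate copies of `ℕ`. -/

/-- A role: a role name `r` or its inverse `r⁻`. -/
inductive Role : Type
  | name (r : ℕ)
  | inv (r : ℕ)
  deriving DecidableEq

/-- Letters of path expressions: roles (possibly inverse) and tests `A?` for concept names `A`. -/
inductive Letter : Type
  | role (R : Role)
  | test (A : ℕ)
  deriving DecidableEq

/-! ## Interpretations -/

/-- An interpretation: a non-empty domain and the meaning of individual names, concept names and
role names. -/
structure Interpretation where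
  Dom : Type
  nonempty : Nonempty Dom
  indiv : ℕ → Dom
  concept : ℕ → Set Dom
  role : ℕ → Set (Dom × Dom)

namespace Interpretation

/-- The binary relation denoted by a role; `r⁻` denotes the converse of the relation of `r`. -/
def roleRel (I : Interpretation) : Role → I.Dom → I.Dom → Prop
  | .name r, d, e => (d, e) ∈ I.role r
  | .inv r, d, e => (e, d) ∈ I.role r

/-- One step of a path that reads a single letter: a role is traversed, a test `A?` stays at an
element of `A`. -/
def letterRel (I : Interpretation) : Letter → I.Dom → I.Dom → Prop
  | .role R, d, e => I.roleRel R d e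
  | .test A, d, e => d = e ∧ d ∈ I.concept A

/-- There is a path from `d` to `e` that is labelled by the given word. -/
def wordRel (I : Interpretation) : List Letter → I.Dom → I.Dom → Prop
  | [], d, e => d = e
  | a :: w, d, e => ∃ d₁, I.letterRel a d d₁ ∧ I.wordRel w d₁ e

/-- `d` can `L`-reach `e`. -/
def Reaches (I : Interpretation) (L : Language Letter) (d e : I.Dom) : Prop :=
  ∃ w ∈ L, I.wordRel w d e

end Interpretation

/-! ## Visibly pushdown automata -/

/-- The kind of a letter of a pushdown alphabet. -/
inductive Kind : Type
  | call
  | internal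
  | ret
  deriving DecidableEq

/-- A visibly pushdown automaton with letters `α`, states `Q` and stack symbols `Γ`. The
bottom-of-stack symbol is not an element of `Γ`: in return transitions it is `none`. -/
structure VPA (α Q Γ : Type) where
  initial : Set Q
  final : Set Q
  callTrans : Set (Q × α × Q × Γ)
  intTrans : Set (Q × α × Q)
  retTrans : Set (Q × α × Option Γ × Q)

namespace VPA

variable {α Q Γ : Type}

/-- The relation `(q, σ) →ₐ (q', σ')` over the pushdown alphabet whose partition is given by
`kind`. A configuration is a state with the stack content above the bottom symbol, top first. -/
inductive Step (kind : α → Kind) (M : VPA α Q Γ) : α → Q × List Γ → Q × List Γ → Prop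
  | call {a : α} {q p : Q} {γ : Γ} {σ : List Γ} :
      kind a = Kind.call → (q, a, p, γ) ∈ M.callTrans → Step kind M a (q, σ) (p, γ :: σ)
  | internal {a : α} {q p : Q} {σ : List Γ} :
      kind a = Kind.internal → (q, a, p) ∈ M.intTrans → Step kind M a (q, σ) (p, σ)
  | ret {a : α} {q p : Q} {γ : Γ} {σ : List Γ} :
      kind a = Kind.ret → (q, a, some γ, p) ∈ M.retTrans → Step kind M a (q, γ :: σ) (p, σ)
  | retBottom {a : α} {q p : Q} :
      kind a = Kind.ret → (q, a, none, p) ∈ M.retTrans → Step kind M a (q, []) (p, [])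

/-- There is a run on the given word between two configurations. -/
def Run (kind : α → Kind) (M : VPA α Q Γ) : List α → Q × List Γ → Q × List Γ → Prop
  | [], c, c' => c = c'
  | a :: w, c, c' => ∃ c₁, Step kind M a c c₁ ∧ Run kind M w c₁ c'

/-- The language of a VPA: acceptance by final state, starting with the empty stack. -/
def lang (kind : α → Kind) (M : VPA α Q Γ) : Language α :=
  {w | ∃ q₀ ∈ M.initial, ∃ q ∈ M.final, ∃ σ : List Γ, Run kind M w (q₀, []) (q, σ)}

end VPA

/-- A finite description of a VPA over two-way letters: its states are `0, …, numStates - 1`, its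
stack symbols (other than the bottom symbol) are `0, …, numStack - 1`, and its initial states,
final states and transitions are listed. -/
structure VPADesc where
  numStates : ℕ
  numStack : ℕ
  initial : List ℕ
  final : List ℕ
  callTrans : List (ℕ × Letter × ℕ × ℕ)
  intTrans : List (ℕ × Letter × ℕ)
  retTrans : List (ℕ × Letter × Option ℕ × ℕ)

/-- The automaton that is described. -/
def VPADesc.toVPA (D : VPADesc) : VPA Letter (Fin D.numStates) (Fin D.numStack) where
  initial := {q | (q : ℕ) ∈ D.initial}
  final := {q | (q : ℕ) ∈ D.final}
  callTrans := {t | ((t.1 : ℕ), t.2.1, (t.2.2.1 : ℕ), (t.2.2.2 : ℕ)) ∈ D.callTrans}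
  intTrans := {t | ((t.1 : ℕ), t.2.1, (t.2.2 : ℕ)) ∈ D.intTrans}
  retTrans := {t | ((t.1 : ℕ), t.2.1, t.2.2.1.map (fun γ => (γ : ℕ)), (t.2.2.2 : ℕ)) ∈ D.retTrans}

/-- A partition of the roles (role names and inverses of role names) into call, internal and
return letters. -/
abbrev RolePartition : Type := Role → Kind

/-- The pushdown alphabet of a role partition; all tests are internal letters. -/
def RolePartition.kind (κ : RolePartition) : Letter → Kind
  | .role R => κ R
  | .test _ => Kind.internal

/-- The visibly pushdown language that a description presents over the partition `κ`. -/
def VPADesc.lang (κ : RolePartition) (D : VPADesc) : Language Letter :=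
  D.toVPA.lang κ.kind

/-- The partition with finitely many call and return roles, given by two lists. -/
def RolePartition.ofLists (P : List Role × List Role) : RolePartition := fun R =>
  if R ∈ P.1 then Kind.call else if R ∈ P.2 then Kind.ret else Kind.internal

/-- For some role names `r`, `s`: the role `s` is a return letter, `s⁻` is a call letter and `r`
is an internal letter. -/
def RolePartition.Suitable (κ : RolePartition) : Prop :=
  ∃ r s : ℕ, κ (Role.name s) = Kind.ret ∧ κ (Role.inv s) = Kind.call ∧
    κ (Role.name r) = Kind.internal

/-! ## ALC-concepts and ALC-TBoxes -/

/-- ALC-concepts: `⊤`, `A`, `¬C`, `C ⊓ D`, `∃r.C` with `r` a role name. -/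
inductive Concept : Type
  | top
  | name (A : ℕ)
  | neg (C : Concept)
  | inter (C D : Concept)
  | ex (r : ℕ) (C : Concept)

/-- The extension of a concept. -/
def Concept.ext (I : Interpretation) : Concept → Set I.Dom
  | .top => Set.univ
  | .name A => I.concept A
  | .neg C => (C.ext I)ᶜ
  | .inter C D => C.ext I ∩ D.ext I
  | .ex r C => {d | ∃ e ∈ C.ext I, (d, e) ∈ I.role r}

/-- An ALC-TBox: a finite list of inclusions `C ⊑ D`, each given as the pair `(C, D)`. -/
abbrev TBox : Type := List (Concept × Concept)

/-- `I` is a model of the TBox. -/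
def TBox.Holds (T : TBox) (I : Interpretation) : Prop :=
  ∀ g ∈ T, g.1.ext I ⊆ g.2.ext I

/-! ## Two-way visibly pushdown path queries -/

/-- A query `L(x, y)`, with `L` presented by an automaton and `x`, `y` variables (possibly the
same one). -/
structure Query where
  aut : VPADesc
  x : ℕ
  y : ℕ

/-- `I` satisfies the query: it has a match. -/
def Query.Holds (κ : RolePartition) (q : Query) (I : Interpretation) : Prop :=
  ∃ η : ℕ → I.Dom, I.Reaches (q.aut.lang κ) (η q.x) (η q.y)

/-- `T` entails `q`: every model of `T` satisfies `q`. -/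
def Entails (κ : RolePartition) (T : TBox) (q : Query) : Prop :=
  ∀ I : Interpretation, T.Holds I → q.Holds κ I

/-! ## Concepts with inverse roles and visibly pushdown path expressions -/

/-- Concepts of `ALC_vpl` with inverses: `⊤`, `A`, `¬C`, `C ⊓ D`, `∃R.C` with `R` a role name or
the inverse of one, and `∃L.C` with `L` presented by an automaton. -/
inductive VplConcept : Type
  | top
  | name (A : ℕ)
  | neg (C : VplConcept)
  | inter (C D : VplConcept)
  | ex (R : Role) (C : VplConcept)
  | exLang (L : VPADesc) (C : VplConcept)

/-- The extension of a concept, the automata being read over the partition `κ`. -/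
def VplConcept.ext (κ : RolePartition) (I : Interpretation) : VplConcept → Set I.Dom
  | .top => Set.univ
  | .name A => I.concept A
  | .neg C => (C.ext κ I)ᶜ
  | .inter C D => C.ext κ I ∩ D.ext κ I
  | .ex R C => {d | ∃ e ∈ C.ext κ I, I.roleRel R d e}
  | .exLang L C => {d | ∃ e ∈ C.ext κ I, I.Reaches (L.lang κ) d e}

/-- The concept has a model. -/
def VplConcept.Satisfiable (κ : RolePartition) (C : VplConcept) : Prop :=
  ∃ I : Interpretation, (C.ext κ I).Nonempty

/-! ## Gödel numberings of the inputs

Each input type is put in an explicit bijection with `ℕ` (or with a product of types that carry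
Mathlib's standard bijection), so that computability over it makes sense. -/

instance : Denumerable Role := Denumerable.ofEquiv (ℕ ⊕ ℕ)
  { toFun := fun R => match R with
      | .name r => Sum.inl r
      | .inv r => Sum.inr r
    invFun := fun x => match x with
      | Sum.inl r => .name r
      | Sum.inr r => .inv r
    left_inv := by rintro (_ | _) <;> rfl
    right_inv := by rintro (_ | _) <;> rfl }

instance : Denumerable Letter := Denumerable.ofEquiv (Role ⊕ ℕ)
  { toFun := fun a => match a with
      | .role R => Sum.inl R
      | .test A => Sum.inr A
    invFun := fun x => match x with
      | Sum.inl R => .role R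
      | Sum.inr A => .test A
    left_inv := by rintro (_ | _) <;> rfl
    right_inv := by rintro (_ | _) <;> rfl }

instance : Denumerable VPADesc := Denumerable.ofEquiv
    (ℕ × ℕ × List ℕ × List ℕ × List (ℕ × Letter × ℕ × ℕ) × List (ℕ × Letter × ℕ) ×
      List (ℕ × Letter × Option ℕ × ℕ))
  { toFun := fun D => (D.numStates, D.numStack, D.initial, D.final, D.callTrans, D.intTrans,
      D.retTrans)
    invFun := fun t => ⟨t.1, t.2.1, t.2.2.1, t.2.2.2.1, t.2.2.2.2.1, t.2.2.2.2.2.1,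
      t.2.2.2.2.2.2⟩
    left_inv := fun _ => rfl
    right_inv := fun _ => rfl }

instance : Denumerable Query := Denumerable.ofEquiv (VPADesc × ℕ × ℕ)
  { toFun := fun q => (q.aut, q.x, q.y)
    invFun := fun t => ⟨t.1, t.2.1, t.2.2⟩
    left_inv := fun _ => rfl
    right_inv := fun _ => rfl }

namespace Concept

/-- The Gödel number of an ALC-concept. -/
def toNat : Concept → ℕ
  | .top => 0
  | .name A => 4 * A + 1
  | .neg C => 4 * C.toNat + 2
  | .inter C D => 4 * Nat.pair C.toNat D.toNat + 3
  | .ex r C => 4 * Nat.pair r C.toNat + 4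

/-- The ALC-concept with a given Gödel number. -/
def ofNat : ℕ → Concept
  | 0 => .top
  | n + 1 =>
    have h : n / 4 < n + 1 := Nat.lt_succ_of_le (Nat.div_le_self n 4)
    have _h₁ : (n / 4).unpair.1 < n + 1 := lt_of_le_of_lt (Nat.unpair_left_le _) h
    have _h₂ : (n / 4).unpair.2 < n + 1 := lt_of_le_of_lt (Nat.unpair_right_le _) h
    match n % 4 with
    | 0 => .name (n / 4)
    | 1 => .neg (ofNat (n / 4))
    | 2 => .inter (ofNat (n / 4).unpair.1) (ofNat (n / 4).unpair.2)
    | _ => .ex (n / 4).unpair.1 (ofNat (n / 4).unpair.2)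

theorem ofNat_toNat (C : Concept) : ofNat C.toNat = C := by
  induction C with
  | top => simp [toNat, ofNat]
  | name A => simp [toNat, ofNat]
  | neg C ih =>
    have h₁ : (4 * C.toNat + 1) / 4 = C.toNat := by omega
    have h₂ : (4 * C.toNat + 1) % 4 = 1 := by omega
    rw [toNat, ofNat, h₁, h₂]
    simp [ih]
  | inter C D ihC ihD =>
    have h₁ : (4 * Nat.pair C.toNat D.toNat + 2) / 4 = Nat.pair C.toNat D.toNat := by omega
    have h₂ : (4 * Nat.pair C.toNat D.toNat + 2) % 4 = 2 := by omega
    rw [toNat, ofNat, h₁, h₂]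
    simp [ihC, ihD]
  | ex r C ih =>
    have h₁ : (4 * Nat.pair r C.toNat + 3) / 4 = Nat.pair r C.toNat := by omega
    have h₂ : (4 * Nat.pair r C.toNat + 3) % 4 = 3 := by omega
    rw [toNat, ofNat, h₁, h₂]
    simp [ih]

theorem toNat_ofNat (n : ℕ) : (ofNat n).toNat = n := by
  induction n using Nat.strong_induction_on with
  | _ n IH =>
    cases n with
    | zero => simp [toNat, ofNat]
    | succ n =>
      have h : n / 4 < n + 1 := Nat.lt_succ_of_le (Nat.div_le_self n 4)
      have h₁ := IH _ (lt_of_le_of_lt (Nat.unpair_left_le (n / 4)) h)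
      have h₂ := IH _ (lt_of_le_of_lt (Nat.unpair_right_le (n / 4)) h)
      have h₃ := IH _ h
      have hm : n % 4 = 0 ∨ n % 4 = 1 ∨ n % 4 = 2 ∨ n % 4 = 3 := by omega
      rw [ofNat]
      rcases hm with hm | hm | hm | hm <;> rw [hm] <;>
        simp only [toNat, h₁, h₂, h₃, Nat.pair_unpair] <;> omega

instance : Denumerable Concept := Denumerable.mk' ⟨toNat, ofNat, ofNat_toNat, toNat_ofNat⟩

end Concept

namespace VplConcept

/-- The Gödel number of a concept. -/
def toNat : VplConcept → ℕ
  | .top => 0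
  | .name A => 5 * A + 1
  | .neg C => 5 * C.toNat + 2
  | .inter C D => 5 * Nat.pair C.toNat D.toNat + 3
  | .ex R C => 5 * Nat.pair (Encodable.encode R) C.toNat + 4
  | .exLang L C => 5 * Nat.pair (Encodable.encode L) C.toNat + 5

/-- The concept with a given Gödel number. -/
def ofNat : ℕ → VplConcept
  | 0 => .top
  | n + 1 =>
    have h : n / 5 < n + 1 := Nat.lt_succ_of_le (Nat.div_le_self n 5)
    have _h₁ : (n / 5).unpair.1 < n + 1 := lt_of_le_of_lt (Nat.unpair_left_le _) h
    have _h₂ : (n / 5).unpair.2 < n + 1 := lt_of_le_of_lt (Nat.unpair_right_le _) h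
    match n % 5 with
    | 0 => .name (n / 5)
    | 1 => .neg (ofNat (n / 5))
    | 2 => .inter (ofNat (n / 5).unpair.1) (ofNat (n / 5).unpair.2)
    | 3 => .ex (Denumerable.ofNat Role (n / 5).unpair.1) (ofNat (n / 5).unpair.2)
    | _ => .exLang (Denumerable.ofNat VPADesc (n / 5).unpair.1) (ofNat (n / 5).unpair.2)

theorem ofNat_toNat (C : VplConcept) : ofNat C.toNat = C := by
  induction C with
  | top => simp [toNat, ofNat]
  | name A => simp [toNat, ofNat]
  | neg C ih =>
    have h₁ : (5 * C.toNat + 1) / 5 = C.toNat := by omega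
    have h₂ : (5 * C.toNat + 1) % 5 = 1 := by omega
    rw [toNat, ofNat, h₁, h₂]
    simp [ih]
  | inter C D ihC ihD =>
    have h₁ : (5 * Nat.pair C.toNat D.toNat + 2) / 5 = Nat.pair C.toNat D.toNat := by omega
    have h₂ : (5 * Nat.pair C.toNat D.toNat + 2) % 5 = 2 := by omega
    rw [toNat, ofNat, h₁, h₂]
    simp [ihC, ihD]
  | ex R C ih =>
    have h₁ : (5 * Nat.pair (Encodable.encode R) C.toNat + 3) / 5
        = Nat.pair (Encodable.encode R) C.toNat := by omega
    have h₂ : (5 * Nat.pair (Encodable.encode R) C.toNat + 3) % 5 = 3 := by omega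
    rw [toNat, ofNat, h₁, h₂]
    simp only [Nat.unpair_pair, Denumerable.ofNat_encode, ih]
  | exLang L C ih =>
    have h₁ : (5 * Nat.pair (Encodable.encode L) C.toNat + 4) / 5
        = Nat.pair (Encodable.encode L) C.toNat := by omega
    have h₂ : (5 * Nat.pair (Encodable.encode L) C.toNat + 4) % 5 = 4 := by omega
    rw [toNat, ofNat, h₁, h₂]
    simp only [Nat.unpair_pair, Denumerable.ofNat_encode, ih]

theorem toNat_ofNat (n : ℕ) : (ofNat n).toNat = n := by
  induction n using Nat.strong_induction_on with
  | _ n IH =>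
    cases n with
    | zero => simp [toNat, ofNat]
    | succ n =>
      have h : n / 5 < n + 1 := Nat.lt_succ_of_le (Nat.div_le_self n 5)
      have h₁ := IH _ (lt_of_le_of_lt (Nat.unpair_left_le (n / 5)) h)
      have h₂ := IH _ (lt_of_le_of_lt (Nat.unpair_right_le (n / 5)) h)
      have h₃ := IH _ h
      have hm : n % 5 = 0 ∨ n % 5 = 1 ∨ n % 5 = 2 ∨ n % 5 = 3 ∨ n % 5 = 4 := by omega
      rw [ofNat]
      rcases hm with hm | hm | hm | hm | hm <;> rw [hm] <;>
        simp only [toNat, h₁, h₂, h₃, Nat.pair_unpair, Denumerable.encode_ofNat] <;> omega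

instance : Denumerable VplConcept := Denumerable.mk' ⟨toNat, ofNat, ofNat_toNat, toNat_ofNat⟩

end VplConcept

end TwoWayVPQ

/-! The halting problem of one fixed universal machine is reduced to both problems. A fixed finite
tile system describes its space-time diagrams, with row `i` showing the configuration at time `i`. A
tiling of the quadrant whose bottom row spells input `n` exists iff the run on that input is
infinite, so solvability is undecidable in `n` (`exists_tileSystem_undecidable`).

In a model, a row is a chain of the role `s`, and the starts of the rows form a chain of the role
`r`. Concepts enforce that successors and tiles exist, that tiles fit along `s`, and how the bottom
row begins. Consecutive rows are out of their reach, because a model need not close the squares of a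
grid. They are compared by a pushdown automaton that searches for an error: it stores a tile in its
state, walks back along `s⁻` pushing at each step, crosses one `r`-edge, and walks forward along `s`
popping. The stack is a counter, so the walk returns to the position where it began, now in the next
row. The empty stack shows only when one more `s` reads the bottom symbol, which leads one position
too far; hence the tile system constrains diagonal instead of vertical neighbours.

If a model has no error path, the tiles on such a comb form a tiling (`solvable_of_model`).
Conversely, in the grid of a tiling `r` and `s` commute, so each run of the automaton compares true
diagonal neighbours and finds no error (`not_reaches_errorAut_grid`). The query asks for an error
path, so entailment means that no tiling exists; the concept forbids error paths, so satisfiability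
means that one exists. Only the length of the initial segment depends on `n`, and the automata are
constant, which makes the reductions computable. -/

namespace TwoWayVPQ

/-! ## Tilings of the quadrant -/

/-- Constraints for tilings of `ℕ × ℕ`: between horizontal neighbours, between diagonal neighbours,
and on the tiles at the start of the bottom row. -/
structure TileSystem (W : Type) where
  horiz : W → W → Prop
  diag : W → W → Prop
  origin : W → Prop
  body : W → Prop
  last : W → Prop

namespace TileSystem

/-- `τ i j` is the tile at position `j` of row `i`. The first `n` tiles of row `0` are body tiles,
the tile at position `n + 1` is a last tile. -/
structure Tiles {W : Type} (P : TileSystem W) (n : ℕ) (τ : ℕ → ℕ → W) : Prop where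
  horiz : ∀ i j, P.horiz (τ i j) (τ i (j + 1))
  diag : ∀ i j, P.diag (τ i j) (τ (i + 1) (j + 1))
  origin : P.origin (τ 0 0)
  body : ∀ j < n, P.body (τ 0 j)
  last : P.last (τ 0 (n + 1))

/-- There is a tiling with an initial segment of length `n`. -/
def Solvable {W : Type} (P : TileSystem W) (n : ℕ) : Prop := ∃ τ, P.Tiles n τ

theorem exists_fin {W : Type} [Finite W] (P : TileSystem W) :
    ∃ (k : ℕ) (P' : TileSystem (Fin k)), ∀ n, P'.Solvable n ↔ P.Solvable n := by
  obtain ⟨k, ⟨e⟩⟩ := Finite.exists_equiv_fin W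
  refine ⟨k, ⟨fun a b => P.horiz (e.symm a) (e.symm b), fun a b => P.diag (e.symm a) (e.symm b),
    fun a => P.origin (e.symm a), fun a => P.body (e.symm a), fun a => P.last (e.symm a)⟩,
    fun n => ⟨?_, ?_⟩⟩
  · rintro ⟨τ, h⟩
    exact ⟨fun i j => e.symm (τ i j), h.horiz, h.diag, h.origin, h.body, h.last⟩
  · rintro ⟨τ, h⟩
    refine ⟨fun i j => e (τ i j), ?_, ?_, ?_, ?_, ?_⟩
    · simpa using h.horiz
    · simpa using h.diag
    · simpa using h.origin
    · simpa using h.body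
    · simpa using h.last

end TileSystem

/-! ## Infinite runs of transition systems -/

theorem not_eval_dom_iff {S : Type} (f : S → Option S) (a : S) :
    ¬ (StateTransition.eval f a).Dom ↔
      ∃ c : ℕ → S, c 0 = a ∧ ∀ i, f (c i) = some (c (i + 1)) := by
  constructor
  · intro h
    have key : ∀ b : {b // StateTransition.Reaches f a b},
        ∃ c : {b // StateTransition.Reaches f a b}, f b.1 = some c.1 := by
      rintro ⟨b, hb⟩
      cases hf : f b with
      | none => exact absurd (Part.dom_iff_mem.2 ⟨b, StateTransition.mem_eval.2 ⟨hb, hf⟩⟩) h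
      | some c => exact ⟨⟨c, hb.tail hf⟩, rfl⟩
    choose g hg using key
    refine ⟨fun i => (g^[i] ⟨a, Relation.ReflTransGen.refl⟩).1, rfl, fun i => ?_⟩
    have := hg (g^[i] ⟨a, Relation.ReflTransGen.refl⟩)
    rwa [← Function.iterate_succ_apply' g i] at this
  · rintro ⟨c, hc0, hc⟩ h
    obtain ⟨b, hb'⟩ := Part.dom_iff_mem.1 h
    obtain ⟨hab, hb⟩ := StateTransition.mem_eval.1 hb'
    have : ∃ i, b = c i := by
      clear hb hb'
      induction hab with
      | refl => exact ⟨0, hc0.symm⟩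
      | tail _ h ih =>
        obtain ⟨i, rfl⟩ := ih
        refine ⟨i + 1, ?_⟩
        rw [hc i] at h
        exact (Option.some_inj.1 h).symm
    obtain ⟨i, rfl⟩ := this
    simp [hc i] at hb

/-! ## Stack machines, one statement at a time -/

namespace StackMachine

open Turing TM2 Function

section

variable {K G Λ σ : Type}

/-- The statement that is executed next (none after halting) and the internal state. -/
abbrev Control (K G Λ σ : Type) : Type := Option (TM2.Stmt (fun _ : K => G) Λ σ) × σ

/-- The control after one statement, given the tops of the stacks. -/
def nextControl (M : Λ → TM2.Stmt (fun _ : K => G) Λ σ) :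
    Control K G Λ σ → (K → Option G) → Option (Control K G Λ σ)
  | (none, _), _ => none
  | (some (.push _ _ q), v), _ => some (some q, v)
  | (some (.peek k f q), v), a => some (some q, f v (a k))
  | (some (.pop k f q), v), a => some (some q, f v (a k))
  | (some (.load f q), v), _ => some (some q, f v)
  | (some (.branch p q₁ q₂), v), _ => some (some (cond (p v) q₁ q₂), v)
  | (some (.goto l), v), _ => some (some (M (l v)), v)
  | (some .halt, v), _ => some (none, v)

variable [DecidableEq K]

/-- The stacks after one statement. -/
def nextStacks : Control K G Λ σ → (K → List G) → K → List G
  | (some (.push k f _), v), S => update S k (f v :: S k)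
  | (some (.pop k _ _), _), S => update S k (S k).tail
  | _, S => S

/-- The execution of one statement. -/
def microStep (M : Λ → TM2.Stmt (fun _ : K => G) Λ σ) (c : Control K G Λ σ × (K → List G)) :
    Option (Control K G Λ σ × (K → List G)) :=
  (nextControl M c.1 fun k => (c.2 k).head?).map fun d => (d, nextStacks c.1 c.2)

/-- The configuration in which the body of the current label is about to be executed. -/
def microCfg (M : Λ → TM2.Stmt (fun _ : K => G) Λ σ) (c : TM2.Cfg (fun _ : K => G) Λ σ) :
    Control K G Λ σ × (K → List G) :=
  ((c.l.map M, c.var), c.stk)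

/-- One step of `TM2.step` runs a whole label body and may touch the stacks many times. A single
statement shifts at most one stack, by one cell, so its effect is visible in a window of three
cells. -/
theorem reaches₁_stepAux (M : Λ → TM2.Stmt (fun _ : K => G) Λ σ)
    (q : TM2.Stmt (fun _ : K => G) Λ σ) (v : σ) (S : K → List G) :
    StateTransition.Reaches₁ (microStep M) ((some q, v), S) (microCfg M (stepAux q v S)) := by
  induction q generalizing v S with
  | push k f q ih => exact Relation.TransGen.head rfl (ih _ _)
  | peek k f q ih => exact Relation.TransGen.head rfl (ih _ _)
  | pop k f q ih => exact Relation.TransGen.head rfl (ih _ _)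
  | load f q ih => exact Relation.TransGen.head rfl (ih _ _)
  | branch p q₁ q₂ ih₁ ih₂ =>
    cases h : p v
    · refine Relation.TransGen.head (b := ((some q₂, v), S)) ?_ ?_
      · simp [microStep, nextControl, h, nextStacks]
      · rw [stepAux, h]; exact ih₂ v S
    · refine Relation.TransGen.head (b := ((some q₁, v), S)) ?_ ?_
      · simp [microStep, nextControl, h, nextStacks]
      · rw [stepAux, h]; exact ih₁ v S
  | goto l => exact Relation.TransGen.single rfl
  | halt => exact Relation.TransGen.single rfl

theorem microStep_eval_dom (M : Λ → TM2.Stmt (fun _ : K => G) Λ σ)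
    (c : TM2.Cfg (fun _ : K => G) Λ σ) :
    (StateTransition.eval (microStep M) (microCfg M c)).Dom ↔
      (StateTransition.eval (TM2.step M) c).Dom := by
  refine StateTransition.tr_eval_dom (tr := fun c d => microCfg M c = d) ?_ rfl
  rw [StateTransition.fun_respects]
  rintro ⟨_ | l, v, S⟩
  · rfl
  · exact reaches₁_stepAux M (M l) v S

-- The control never leaves the finite set `stmts M L`, so finitely many tiles suffice for an
-- infinite run.
omit [DecidableEq K] in
theorem nextControl_mem_stmts [Inhabited Λ] {M : Λ → TM2.Stmt (fun _ : K => G) Λ σ} {L : Finset Λ}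
    (hL : Supports M L) {c d : Control K G Λ σ} {a : K → Option G} (hc : c.1 ∈ stmts M L)
    (h : nextControl M c a = some d) : d.1 ∈ stmts M L := by
  classical
  have sub : ∀ {q₁ q₂ : TM2.Stmt (fun _ : K => G) Λ σ}, some q₂ ∈ stmts M L → q₁ ∈ stmts₁ q₂ →
      some q₁ ∈ stmts M L := fun h₁ h₂ => stmts_trans h₂ h₁
  obtain ⟨_ | q, v⟩ := c
  · simp [nextControl] at h
  · cases q with
    | branch p q₁ q₂ =>
      simp only [nextControl, Option.some.injEq] at h
      subst h
      refine sub hc ?_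
      cases p v <;> simp [stmts₁, stmts₁_self]
    | goto l =>
      simp only [nextControl, Option.some.injEq] at h
      subst h
      have := stmts_supportsStmt hL hc v
      simp only [stmts, Finset.some_mem_insertNone, Finset.mem_biUnion]
      exact ⟨_, this, stmts₁_self⟩
    | halt =>
      simp only [nextControl, Option.some.injEq] at h
      subst h
      simp [stmts]
    | _ =>
      simp only [nextControl, Option.some.injEq] at h
      subst h
      exact sub hc (by simp [stmts₁, stmts₁_self])

/-! ### Configurations as rows of cells -/

/-- A marker for the first cell of a row, and for each stack the symbol at the position of the cell,
counted from the top. -/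
abbrev Cell (K G : Type) : Type := Bool × (K → Option G)

/-- The cell at position `j`. -/
def cell (S : K → List G) (j : ℕ) : Cell K G := (decide (j = 0), fun k => (S k)[j]?)

/-- A cell after one statement, as a function of the cells to its left, at its position, and to
its right. -/
def nextCell : Control K G Λ σ → Cell K G → Cell K G → Cell K G → Cell K G
  | (some (.push k f _), v), l, c, _ => (c.1, update c.2 k (if c.1 then some (f v) else l.2 k))
  | (some (.pop k _ _), _), _, c, r => (c.1, update c.2 k (r.2 k))
  | _, _, c, _ => c

/-- The cell `l` is arbitrary: at a marked cell a push writes the new symbol instead of copying from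
the left. Hence the edge of the quadrant needs no constraint. -/
theorem cell_nextStacks_zero (c : Control K G Λ σ) (S : K → List G) (l : Cell K G) :
    cell (nextStacks c S) 0 = nextCell c l (cell S 0) (cell S 1) := by
  obtain ⟨_ | q, v⟩ := c
  · rfl
  · cases q with
    | push k f q =>
      refine Prod.ext rfl (funext fun k' => ?_)
      by_cases h : k' = k
      · subst h; simp [cell, nextStacks, nextCell]
      · simp [cell, nextStacks, nextCell, h]
    | pop k f q =>
      refine Prod.ext rfl (funext fun k' => ?_)
      by_cases h : k' = k
      · subst h; simp [cell, nextStacks, nextCell]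
      · simp [cell, nextStacks, nextCell, h]
    | _ => rfl

theorem cell_nextStacks_succ (c : Control K G Λ σ) (S : K → List G) (j : ℕ) :
    cell (nextStacks c S) (j + 1) =
      nextCell c (cell S j) (cell S (j + 1)) (cell S (j + 2)) := by
  obtain ⟨_ | q, v⟩ := c
  · rfl
  · cases q with
    | push k f q =>
      refine Prod.ext rfl (funext fun k' => ?_)
      by_cases h : k' = k
      · subst h; simp [cell, nextStacks, nextCell]
      · simp [cell, nextStacks, nextCell, h]
    | pop k f q =>
      refine Prod.ext rfl (funext fun k' => ?_)
      by_cases h : k' = k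
      · subst h; simp [cell, nextStacks, nextCell]
      · simp [cell, nextStacks, nextCell, h]
    | _ => rfl

/-- A tile: the control, which is the same in the whole row, and a window of three cells. -/
structure Tile (K G Λ σ : Type) (F : Finset (Option (TM2.Stmt (fun _ : K => G) Λ σ))) where
  stmt : F
  var : σ
  left : Cell K G
  cur : Cell K G
  right : Cell K G

instance [Finite K] [Finite G] [Finite σ] (F : Finset (Option (TM2.Stmt (fun _ : K => G) Λ σ))) :
    Finite (Tile K G Λ σ F) :=
  Finite.of_injective
    (fun t : Tile K G Λ σ F => (t.stmt, t.var, t.left, t.cur, t.right)) (by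
      rintro ⟨⟩ ⟨⟩ h
      simpa using h)

/-- The control of a tile. -/
def Tile.control {F : Finset (Option (TM2.Stmt (fun _ : K => G) Λ σ))} (t : Tile K G Λ σ F) :
    Control K G Λ σ := (t.stmt.1, t.var)

/-- The tile system whose tilings are the infinite runs from control `c₀` with all stacks empty but
the stack `k₀`, which holds `n` symbols `a` followed by `b` and `c`. -/
def tileSystem (M : Λ → TM2.Stmt (fun _ : K => G) Λ σ)
    (F : Finset (Option (TM2.Stmt (fun _ : K => G) Λ σ))) (c₀ : Control K G Λ σ) (k₀ : K)
    (a b c : G) : TileSystem (Tile K G Λ σ F) where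
  horiz t u := u.control = t.control ∧ u.left = t.cur ∧ u.cur = t.right ∧ t.right.1 = false ∧
    ∀ k, t.cur.2 k = none → t.right.2 k = none
  diag t u := (t.cur.1 = true → nextControl M t.control t.cur.2 = some u.control) ∧
    u.left = nextCell t.control t.left t.cur t.right
  origin t := t.control = c₀ ∧ t.cur.1 = true ∧ ∀ k, k ≠ k₀ → t.cur.2 k = none
  body t := t.cur.2 k₀ = some a
  last t := t.left.2 k₀ = some b ∧ t.cur.2 k₀ = some c ∧ t.right.2 k₀ = none

/-- The initial stacks. -/
def initStacks (k₀ : K) (a b c : G) (n : ℕ) : K → List G :=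
  update (fun _ => []) k₀ (List.replicate n a ++ [b, c])

section Tiling

variable {M : Λ → TM2.Stmt (fun _ : K => G) Λ σ}
  {F : Finset (Option (TM2.Stmt (fun _ : K => G) Λ σ))} {c₀ : Control K G Λ σ} {k₀ : K}
  {a b c : G} {n : ℕ} {τ : ℕ → ℕ → Tile K G Λ σ F}

theorem control_eq (h : (tileSystem M F c₀ k₀ a b c).Tiles n τ) (i j : ℕ) :
    (τ i j).control = (τ i 0).control := by
  induction j with
  | zero => rfl
  | succ j ih => rw [(h.horiz i j).1, ih]

/-- The body tiles fix the positions below `n` of stack `k₀`, and the window of the last tile fixes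
`n`, `n + 1` and `n + 2`. Emptiness spreads to the right, from `n + 2` on this stack and from the
origin on the others. -/
theorem cur_eq_cell_of_row_zero (h : (tileSystem M F c₀ k₀ a b c).Tiles n τ) (j : ℕ) :
    (τ 0 j).cur = cell (initStacks k₀ a b c n) j := by
  have hnone : ∀ k j, (τ 0 j).cur.2 k = none → ∀ m, (τ 0 (j + m)).cur.2 k = none := by
    intro k j hj m
    induction m with
    | zero => exact hj
    | succ m ih =>
      have := h.horiz 0 (j + m)
      rw [← add_assoc, this.2.2.1]
      exact this.2.2.2.2 k ih
  refine Prod.ext ?_ (funext fun k => ?_)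
  · cases j with
    | zero => simpa [cell] using h.origin.2.1
    | succ j =>
      rw [(h.horiz 0 j).2.2.1, (h.horiz 0 j).2.2.2.1]
      simp [cell]
  · by_cases hk : k = k₀
    · subst hk
      have hl := h.last
      have h₁ : (τ 0 n).cur.2 k = some b := by
        rw [← (h.horiz 0 n).2.1]; exact hl.1
      have h₃ : (τ 0 (n + 2)).cur.2 k = none := by
        rw [(h.horiz 0 (n + 1)).2.2.1]; exact hl.2.2
      simp only [cell, initStacks, update_self]
      rcases lt_trichotomy j n with hj | rfl | hj
      · rw [List.getElem?_append_left (by simpa using hj)]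
        have hb : (τ 0 j).cur.2 k = some a := h.body j hj
        simpa [hj] using hb
      · simpa using h₁
      · obtain ⟨m, rfl⟩ := Nat.exists_eq_add_of_lt hj
        cases m with
        | zero =>
          rw [List.getElem?_append_right (by simp)]
          simpa [Nat.add_sub_cancel_left, add_assoc] using hl.2.1
        | succ m =>
          have := hnone k _ h₃ m
          rw [show n + (m + 1) + 1 = n + 2 + m by omega, this]
          simp
    · have := hnone k 0 (h.origin.2.2 k hk) j
      rw [zero_add] at this
      simp [cell, initStacks, hk, this]

theorem exists_run (h : (tileSystem M F c₀ k₀ a b c).Tiles n τ) :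
    ∃ S : ℕ → K → List G, S 0 = initStacks k₀ a b c n ∧
      ∀ i, microStep M ((τ i 0).control, S i) = some ((τ (i + 1) 0).control, S (i + 1)) := by
  let S : ℕ → K → List G := fun i =>
    Nat.rec (initStacks k₀ a b c n) (fun i T => nextStacks (τ i 0).control T) i
  have hS : ∀ i j, (τ i j).cur = cell (S i) j := by
    intro i
    induction i with
    | zero => exact cur_eq_cell_of_row_zero h
    | succ i ih =>
      intro j
      -- The cell at position `j` is read as the left cell of the tile at `j + 1`, the diagonal
      -- neighbour of the tile below position `j`.
      rw [← (h.horiz (i + 1) j).2.1, (h.diag i j).2, control_eq h, ← (h.horiz i j).2.2.1]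
      cases j with
      | zero => rw [ih, ih]; exact (cell_nextStacks_zero _ _ _).symm
      | succ j =>
        rw [(h.horiz i j).2.1, ih, ih, ih]; exact (cell_nextStacks_succ _ _ _).symm
  refine ⟨S, rfl, fun i => ?_⟩
  have h₁ := (h.diag i 0).1 (by rw [hS]; rfl)
  rw [control_eq h (i + 1)] at h₁
  have h₂ : (fun k => (S i k).head?) = (τ i 0).cur.2 := by
    rw [hS]
    funext k
    simp [cell, List.head?_eq_getElem?]
  simp only [microStep, h₂, h₁, Option.map_some]
  rfl

end Tiling

theorem tileSystem_solvable_iff [Inhabited Λ] {M : Λ → TM2.Stmt (fun _ : K => G) Λ σ}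
    {L : Finset Λ} (hL : Supports M L) {c₀ : Control K G Λ σ} (hc₀ : c₀.1 ∈ stmts M L) (k₀ : K)
    (a b c : G) (n : ℕ) :
    (tileSystem M (stmts M L) c₀ k₀ a b c).Solvable n ↔
      ¬ (StateTransition.eval (microStep M) (c₀, initStacks k₀ a b c n)).Dom := by
  rw [not_eval_dom_iff]
  constructor
  · rintro ⟨τ, h⟩
    obtain ⟨S, hS₀, hS⟩ := exists_run h
    exact ⟨fun i => ((τ i 0).control, S i), Prod.ext h.origin.1 hS₀, hS⟩
  · rintro ⟨d, hd₀, hd⟩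
    have hd' : ∀ i, nextControl M (d i).1 (fun k => ((d i).2 k).head?) = some (d (i + 1)).1 ∧
        (d (i + 1)).2 = nextStacks (d i).1 (d i).2 := by
      intro i
      have := hd i
      simp only [microStep, Option.map_eq_some_iff] at this
      obtain ⟨e, he, hde⟩ := this
      rw [← hde]
      exact ⟨he, rfl⟩
    have hmem : ∀ i, (d i).1.1 ∈ stmts M L := by
      intro i
      induction i with
      | zero => rw [hd₀]; exact hc₀
      | succ i ih => exact nextControl_mem_stmts hL ih (hd' i).1
    have hhead : ∀ i, (cell (d i).2 0).2 = fun k => ((d i).2 k).head? := by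
      intro i
      funext k
      simp [cell, List.head?_eq_getElem?]
    have hnone : ∀ (S : K → List G) j k, (cell S j).2 k = none → (cell S (j + 1)).2 k = none := by
      intro S j k h
      simp only [cell, List.getElem?_eq_none_iff] at h ⊢
      omega
    -- For `j = 0` the truncated `j - 1` puts an irrelevant cell to the left of the edge.
    refine ⟨fun i j => ⟨⟨(d i).1.1, hmem i⟩, (d i).1.2, cell (d i).2 (j - 1), cell (d i).2 j,
      cell (d i).2 (j + 1)⟩, ?_, ?_, ?_, ?_, ?_⟩
    · intro i j
      exact ⟨rfl, rfl, rfl, by simp [cell], hnone _ _⟩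
    · intro i j
      refine ⟨fun h => ?_, ?_⟩
      · have : j = 0 := by simpa [cell] using h
        subst this
        rw [hhead]
        exact (hd' i).1
      · change cell (d (i + 1)).2 j = _
        rw [(hd' i).2]
        cases j with
        | zero => exact cell_nextStacks_zero _ _ _
        | succ j => exact cell_nextStacks_succ _ _ _
    · simp only [tileSystem, Tile.control, hd₀]
      refine ⟨trivial, by simp [cell], fun k hk => by simp [cell, initStacks, hk]⟩
    · intro j hj
      simp [tileSystem, hd₀, cell, initStacks, List.getElem?_append_left, hj]
    · simp [tileSystem, hd₀, cell, initStacks]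

end

/-! ## A tiling problem that is undecidable in the length of the initial segment -/

/-- The input `n` is passed as `2 ^ n`, whose binary code, least digit first, is `n` equal symbols
and a fixed ending. Rows of this shape are described by a segment of which only the length varies.
-/
theorem partrec_halting_log : Partrec fun m : ℕ =>
    (Nat.rfind fun k => Part.some (decide (2 ^ k = m))).bind
      fun k => (Denumerable.ofNat Nat.Partrec.Code k).eval 0 := by
  refine Partrec.bind (Partrec.rfind (p := fun m k => Part.some (decide (2 ^ k = m))) ?_) ?_
  · have hpow : Primrec fun p : ℕ × ℕ => 2 ^ p.2 :=
      (Primrec₂.unpaired'.1 Nat.Primrec.pow).comp (Primrec.const 2) Primrec.snd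
    have heq : PrimrecPred fun p : ℕ × ℕ => 2 ^ p.2 = p.1 := Primrec.eq.comp hpow Primrec.fst
    exact heq.decide.to_comp.partrec
  · exact Nat.Partrec.Code.eval_part.comp ((Computable.ofNat _).comp Computable.snd)
      (Computable.const 0)

theorem halting_log_two_pow (n : ℕ) :
    ((Nat.rfind fun k => Part.some (decide (2 ^ k = 2 ^ n))).bind
      fun k => (Denumerable.ofNat Nat.Partrec.Code k).eval 0) =
        (Denumerable.ofNat Nat.Partrec.Code n).eval 0 := by
  have : (Nat.rfind fun k => Part.some (decide (2 ^ k = 2 ^ n))) = Part.some n := by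
    refine Part.eq_some_iff.2 (Nat.mem_rfind.2 ⟨by simp, fun {m} hm => ?_⟩)
    simp only [Part.mem_some_iff]
    exact (decide_eq_false (by simpa using hm.ne)).symm
  rw [this, Part.bind_some]

theorem not_computablePred_halting :
    ¬ ComputablePred fun n : ℕ => ((Denumerable.ofNat Nat.Partrec.Code n).eval 0).Dom := by
  intro h
  refine ComputablePred.halting_problem 0 (ComputablePred.computable_of_manyOneReducible ?_ h)
  exact ⟨Encodable.encode, Computable.encode, fun c => by simp⟩

theorem trList_two_pow (n : ℕ) : PartrecToTM2.trList [2 ^ n] =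
    List.replicate n PartrecToTM2.Γ'.bit0 ++ [PartrecToTM2.Γ'.bit1, PartrecToTM2.Γ'.cons] := by
  have key : ∀ n : ℕ, ∃ p : PosNum, ((2 ^ n : ℕ) : Num) = Num.pos p ∧ PartrecToTM2.trPosNum p =
      List.replicate n PartrecToTM2.Γ'.bit0 ++ [PartrecToTM2.Γ'.bit1] := by
    intro n
    induction n with
    | zero => exact ⟨.one, rfl, rfl⟩
    | succ n ih =>
      obtain ⟨p, hp, hl⟩ := ih
      refine ⟨p.bit0, ?_, ?_⟩
      · apply Num.to_nat_inj.1
        have h2 := congrArg (fun m : Num => (m : ℕ)) hp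
        simp only [Num.to_of_nat] at h2 ⊢
        rw [pow_succ, h2]
        simp [PosNum.cast_bit0, mul_two]
      · rw [PartrecToTM2.trPosNum, hl, List.replicate_succ, List.cons_append]
  obtain ⟨p, hp, hl⟩ := key n
  simp [PartrecToTM2.trList, PartrecToTM2.trNat, hp, PartrecToTM2.trNum, hl]

instance : Finite PartrecToTM2.K' :=
  Finite.of_injective
    (fun k => match k with
      | .main => (0 : Fin 4) | .rev => 1 | .aux => 2 | .stack => 3)
    (by rintro (_ | _) (_ | _) <;> simp)

theorem exists_tileSystem_undecidable :
    ∃ (k : ℕ) (P : TileSystem (Fin k)), ¬ ComputablePred fun n => P.Solvable n := by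
  classical
  obtain ⟨c, hc⟩ := Turing.ToPartrec.Code.exists_code
    (Nat.Partrec'.part_iff₁.2 partrec_halting_log)
  -- `Supports` requires the default label to lie in the support, so the start label is made the
  -- default.
  let : Inhabited PartrecToTM2.Λ' := ⟨PartrecToTM2.trNormal c .halt⟩
  let M : PartrecToTM2.Λ' → TM2.Stmt (fun _ : PartrecToTM2.K' => PartrecToTM2.Γ') PartrecToTM2.Λ'
    (Option PartrecToTM2.Γ') := PartrecToTM2.tr
  let L := PartrecToTM2.codeSupp c .halt
  have hL : Supports M L := PartrecToTM2.tr_supports c .halt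
  let c₀ : Control PartrecToTM2.K' PartrecToTM2.Γ' PartrecToTM2.Λ' (Option PartrecToTM2.Γ') :=
    (some (M (PartrecToTM2.trNormal c .halt)), none)
  have hc₀ : c₀.1 ∈ stmts M L := by
    exact Finset.some_mem_insertNone.2 (Finset.mem_biUnion.2 ⟨_, hL.1, stmts₁_self⟩)
  let init : ℕ → TM2.Cfg (fun _ : PartrecToTM2.K' => PartrecToTM2.Γ') PartrecToTM2.Λ'
    (Option PartrecToTM2.Γ') := fun n => PartrecToTM2.init c [2 ^ n]
  obtain ⟨k, P, hP⟩ := (tileSystem M (stmts M L) c₀ .main .bit0 .bit1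
    .cons).exists_fin
  refine ⟨k, P, fun h => not_computablePred_halting ?_⟩
  refine h.not.of_eq fun n => ?_
  rw [hP, tileSystem_solvable_iff hL hc₀, not_not]
  have h₁ : (c₀, initStacks PartrecToTM2.K'.main PartrecToTM2.Γ'.bit0 PartrecToTM2.Γ'.bit1
      PartrecToTM2.Γ'.cons n) = microCfg M (init n) := by
    refine Prod.ext rfl (funext fun k => ?_)
    simp only [initStacks, microCfg, init, PartrecToTM2.init, trList_two_pow]
    cases k <;> rfl
  have h₂ := hc ⟨[2 ^ n], rfl⟩
  have h₃ : StateTransition.eval (TM2.step M) (init n) = PartrecToTM2.halt <$> c.eval [2 ^ n] :=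
    PartrecToTM2.tr_eval c [2 ^ n]
  rw [h₁, microStep_eval_dom, ← halting_log_two_pow n]
  have h₄ : (StateTransition.eval (TM2.step M) (init n)).Dom ↔
      (c.eval [2 ^ n]).Dom := by
    rw [h₃]; rfl
  rw [h₄]
  change c.eval [2 ^ n] = _ at h₂
  rw [h₂]
  rfl

end StackMachine

/-! ## Paths along runs of a visibly pushdown automaton -/

/-- One letter is read by the automaton and traversed in the interpretation. -/
def PathStep (kind : Letter → Kind) {Q Γ : Type} (M : VPA Letter Q Γ) (I : Interpretation)
    (x y : (Q × List Γ) × I.Dom) : Prop :=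
  ∃ a, VPA.Step kind M a x.1 y.1 ∧ I.letterRel a x.2 y.2

/-- Passing to the product of configurations and elements eliminates the words and allows invariants
along paths. -/
theorem reaches_lang_iff {kind : Letter → Kind} {Q Γ : Type} {M : VPA Letter Q Γ}
    {I : Interpretation} {d e : I.Dom} :
    I.Reaches (M.lang kind) d e ↔ ∃ q₀ ∈ M.initial, ∃ q ∈ M.final, ∃ σ : List Γ,
      Relation.ReflTransGen (PathStep kind M I) ((q₀, []), d) ((q, σ), e) := by
  have key : ∀ (c c' : Q × List Γ) (d e : I.Dom),
      (∃ w, I.wordRel w d e ∧ M.Run kind w c c') ↔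
        Relation.ReflTransGen (PathStep kind M I) (c, d) (c', e) := by
    intro c c' d e
    constructor
    · rintro ⟨w, hw, hr⟩
      induction w generalizing c d with
      | nil =>
        obtain rfl : d = e := hw
        obtain rfl : c = c' := hr
        exact .refl
      | cons a w ih =>
        obtain ⟨d₁, h₁, hw⟩ := hw
        obtain ⟨c₁, h₂, hr⟩ := hr
        exact .head ⟨a, h₂, h₁⟩ (ih _ _ hw hr)
    · intro h
      generalize hx : (c, d) = x at h
      induction h using Relation.ReflTransGen.head_induction_on generalizing c d with
      | refl =>
        cases hx
        exact ⟨[], rfl, rfl⟩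
      | head h _ ih =>
        subst hx
        obtain ⟨a, h₁, h₂⟩ := h
        obtain ⟨w, hw, hr⟩ := ih _ _ rfl
        exact ⟨a :: w, ⟨_, h₂, hw⟩, ⟨_, h₁, hr⟩⟩
  constructor
  · rintro ⟨w, ⟨q₀, h₀, q, hq, σ, hr⟩, hw⟩
    exact ⟨q₀, h₀, q, hq, σ, (key _ _ _ _).1 ⟨w, hw, hr⟩⟩
  · rintro ⟨q₀, h₀, q, hq, σ, h⟩
    obtain ⟨w, hw, hr⟩ := (key _ _ _ _).2 h
    exact ⟨w, ⟨q₀, h₀, q, hq, σ, hr⟩, hw⟩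

/-! ## Concepts that describe tilings -/

namespace Concept

/-- `∀r.C` -/
def all (r : ℕ) (C : Concept) : Concept := neg (ex r (neg C))

/-- No tile with a name outside `p` is present. -/
noncomputable def only {k : ℕ} (p : Fin k → Prop) : Concept :=
  open Classical in
  ((List.finRange k).filter fun t => ¬ p t).foldr (fun (t : Fin k) C => inter (neg (name t)) C) top

/-- The conjunction of a list of concepts. -/
def conj (l : List Concept) : Concept := l.foldr inter top

variable {I : Interpretation} {d : I.Dom}

theorem mem_ext_all {r : ℕ} {C : Concept} :
    d ∈ (all r C).ext I ↔ ∀ e, (d, e) ∈ I.role r → e ∈ C.ext I := by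
  simp only [all, ext, Set.mem_compl_iff, Set.mem_ofPred_eq, not_exists, not_and]
  exact ⟨fun h e he => by_contra fun hC => h e hC he, fun h e hC he => hC (h e he)⟩

theorem mem_ext_conj {l : List Concept} : d ∈ (conj l).ext I ↔ ∀ C ∈ l, d ∈ C.ext I := by
  induction l with
  | nil => simp [conj, ext]
  | cons C l ih =>
    rw [conj, List.foldr_cons, ext, ← conj, Set.mem_inter_iff, ih, List.forall_mem_cons]

/-- An element of a model may carry several tile names. Constraining all of them makes any choice of
one name safe. -/
theorem mem_ext_only {k : ℕ} {p : Fin k → Prop} :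
    d ∈ (only p).ext I ↔ ∀ t : Fin k, d ∈ I.concept t → p t := by
  classical
  have key : ∀ l : List (Fin k), d ∈ (l.foldr (fun (t : Fin k) C => inter (neg (name t)) C) top).ext I ↔
      ∀ t ∈ l, d ∉ I.concept t := by
    intro l
    induction l with
    | nil => simp [ext]
    | cons t l ih => simp [ext, ih]
  rw [only, key]
  simp only [List.mem_filter, List.mem_finRange, true_and, decide_eq_true_eq]
  exact forall_congr' fun t => ⟨fun h ht => by_contra fun hp => h hp ht, fun h hp ht => hp (h ht)⟩

end Concept

namespace TileSystem

open TwoWayVPQ.Concept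

variable {k : ℕ} (P : TileSystem (Fin k)) (r s : ℕ)

/-- Every element has successors and a tile, and the tiles fit horizontally. -/
noncomputable def localConcept : Concept :=
  conj ([ex r top, ex s top, neg (only fun _ : Fin k => False)] ++
    (List.finRange k).map fun (t : Fin k) => neg (inter (name t) (neg (all s (only (P.horiz t))))))

/-- The initial segment of length `n`, but for the condition on the origin. -/
noncomputable def segmentConcept : ℕ → Concept
  | 0 => all s (only P.last)
  | n + 1 => inter (only P.body) (all s (segmentConcept n))

/-- The start of row `0`, with an initial segment of length `n`. -/
noncomputable def startConcept (n : ℕ) : Concept := inter (only P.origin) (P.segmentConcept s n)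

/-- The automaton that finds tiles that do not fit diagonally: after a tile, it climbs the column,
changes to the next one, and descends to one below the height at which it started. -/
noncomputable def errorAut : VPADesc :=
  open Classical in
  { numStates := 3 * k + 2
    numStack := 1
    initial := [0]
    final := [1]
    callTrans := (List.finRange k).map fun (t : Fin k) => (3 * t + 2, .role (.inv s), 3 * t + 2, 0)
    intTrans := (List.finRange k).flatMap fun (t : Fin k) =>
      (0, .test t, 3 * t + 2) :: (3 * t + 2, .role (.name r), 3 * t + 3) ::
        ((List.finRange k).filter fun u => ¬ P.diag t u).map fun (u : Fin k) => (3 * t + 4, .test u, 1)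
    retTrans := (List.finRange k).flatMap fun (t : Fin k) =>
      [(3 * t + 3, .role (.name s), some 0, 3 * t + 3),
        (3 * t + 3, .role (.name s), none, 3 * t + 4)] }

variable {P r s}

theorem mem_ext_localConcept {I : Interpretation} {d : I.Dom} :
    d ∈ (P.localConcept r s).ext I ↔ (∃ e, (d, e) ∈ I.role r) ∧ (∃ e, (d, e) ∈ I.role s) ∧
      (∃ t : Fin k, d ∈ I.concept t) ∧ ∀ t : Fin k, d ∈ I.concept t → ∀ e, (d, e) ∈ I.role s →
        ∀ u : Fin k, e ∈ I.concept u → P.horiz t u := by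
  rw [localConcept, mem_ext_conj]
  simp only [List.mem_append, or_imp, forall_and, List.forall_mem_cons, List.mem_map,
    List.mem_finRange, true_and, forall_exists_index, forall_apply_eq_imp_iff, List.not_mem_nil,
    false_imp_iff, implies_true, and_true, and_assoc]
  refine and_congr (by simp [ext]) (and_congr (by simp [ext]) (and_congr ?_ ?_))
  · rw [ext, Set.mem_compl_iff, mem_ext_only]
    simp
  · refine forall_congr' fun t => ?_
    simp only [ext, Set.mem_compl_iff, Set.mem_inter_iff, not_and, not_not, mem_ext_all,
      mem_ext_only]

theorem segment_of_mem_ext {I : Interpretation} {d : ℕ → I.Dom} {t : ℕ → Fin k} {n : ℕ}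
    (hs : ∀ j, (d j, d (j + 1)) ∈ I.role s) (ht : ∀ j, d j ∈ I.concept (t j))
    (h : d 0 ∈ (P.segmentConcept s n).ext I) : (∀ j < n, P.body (t j)) ∧ P.last (t (n + 1)) := by
  induction n generalizing d t with
  | zero => exact ⟨by simp, mem_ext_only.1 (mem_ext_all.1 h _ (hs 0)) _ (ht 1)⟩
  | succ n ih =>
    obtain ⟨h₁, h₂⟩ := ih (d := fun j => d (j + 1)) (t := fun j => t (j + 1))
      (fun j => hs _) (fun j => ht _) (mem_ext_all.1 h.2 _ (hs 0))
    refine ⟨fun j hj => ?_, h₂⟩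
    cases j with
    | zero => exact mem_ext_only.1 h.1 _ (ht 0)
    | succ j => exact h₁ j (by omega)

/-! ## From models to tilings -/

section Model

variable {κ : RolePartition} {I : Interpretation}

/-- Only the starts of the two chains are linked by `r`; the counter carries the comparison to any
depth. -/
theorem reaches_errorAut (hr : κ (.name r) = .internal) (hs : κ (.name s) = .ret)
    (hs' : κ (.inv s) = .call) {d d' : ℕ → I.Dom} (hd : ∀ j, (d j, d (j + 1)) ∈ I.role s)
    (hd' : ∀ j, (d' j, d' (j + 1)) ∈ I.role s) (h : (d 0, d' 0) ∈ I.role r) {j : ℕ} {t u : Fin k}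
    (ht : d j ∈ I.concept t) (hu : d' (j + 1) ∈ I.concept u) (htu : ¬ P.diag t u) :
    I.Reaches ((P.errorAut r s).lang κ) (d j) (d' (j + 1)) := by
  classical
  let M := (P.errorAut r s).toVPA
  let R := PathStep κ.kind M I
  have hk := t.2
  have hn : (P.errorAut r s).numStates = 3 * k + 2 := rfl
  let st : Fin (P.errorAut r s).numStates := ⟨0, by omega⟩
  let fi : Fin (P.errorAut r s).numStates := ⟨1, by omega⟩
  let up : Fin (P.errorAut r s).numStates := ⟨3 * t + 2, by omega⟩
  let dn : Fin (P.errorAut r s).numStates := ⟨3 * t + 3, by omega⟩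
  let en : Fin (P.errorAut r s).numStates := ⟨3 * t + 4, by omega⟩
  let z : Fin (P.errorAut r s).numStack := ⟨0, Nat.one_pos⟩
  have climb : ∀ (j : ℕ) (σ : List (Fin (P.errorAut r s).numStack)),
      Relation.ReflTransGen R ((up, σ), d j) ((up, List.replicate j z ++ σ), d 0) := by
    intro j
    induction j with
    | zero => exact fun σ => .refl
    | succ j ih =>
      intro σ
      refine .head (b := ((up, z :: σ), d j)) ⟨.role (.inv s), .call hs' ?_, hd j⟩ ?_
      · exact List.mem_map.2 ⟨t, List.mem_finRange t, rfl⟩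
      · rw [List.replicate_succ', List.append_assoc]
        exact ih (z :: σ)
  have descend : ∀ (j i : ℕ), Relation.ReflTransGen R ((dn, List.replicate j z), d' i)
      ((dn, []), d' (i + j)) := by
    intro j
    induction j with
    | zero => exact fun i => .refl
    | succ j ih =>
      intro i
      refine .head (b := ((dn, List.replicate j z), d' (i + 1)))
        ⟨.role (.name s), .ret hs ?_, hd' i⟩ ?_
      · exact List.mem_flatMap.2 ⟨t, List.mem_finRange t, by simp [dn, z]⟩
      · rw [add_comm j, ← add_assoc]
        exact ih (i + 1)
  refine reaches_lang_iff.2 ⟨st, List.mem_singleton.2 rfl, fi,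
    List.mem_singleton.2 rfl, [], ?_⟩
  refine .head (b := ((up, []), d j)) ⟨.test t, .internal rfl ?_, rfl, ht⟩ ?_
  · exact List.mem_flatMap.2 ⟨t, List.mem_finRange t, by simp [st, up]⟩
  refine (climb j []).trans ?_
  rw [List.append_nil]
  refine .head (b := ((dn, List.replicate j z), d' 0)) ⟨.role (.name r), .internal hr ?_, h⟩ ?_
  · exact List.mem_flatMap.2 ⟨t, List.mem_finRange t, by simp [up, dn]⟩
  refine (descend j 0).trans ?_
  rw [zero_add]
  -- Reading the bottom symbol certifies that the counter is zero and costs the extra `s`-step to `j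
  -- + 1`.
  refine .head (b := ((en, []), d' (j + 1))) ⟨.role (.name s), .retBottom hs ?_, hd' j⟩ ?_
  · exact List.mem_flatMap.2 ⟨t, List.mem_finRange t, by simp [dn, en]⟩
  refine .single ⟨.test u, .internal rfl ?_, rfl, hu⟩
  exact List.mem_flatMap.2 ⟨t, List.mem_finRange t, by simpa [en, fi] using ⟨u, htu, rfl⟩⟩

/-- The tiling is read off a comb of chosen successors. For entailment `X` is the whole domain,
where the TBox holds; for satisfiability it is the part reachable from `d₀` along `r` and `s`,
beyond which the concept says nothing. -/
theorem solvable_of_model (hr : κ (.name r) = .internal) (hs : κ (.name s) = .ret)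
    (hs' : κ (.inv s) = .call) (X : Set I.Dom) (hX : ∀ d ∈ X, d ∈ (P.localConcept r s).ext I)
    (hXr : ∀ d ∈ X, ∀ e, (d, e) ∈ I.role r → e ∈ X)
    (hXs : ∀ d ∈ X, ∀ e, (d, e) ∈ I.role s → e ∈ X)
    (herr : ∀ d ∈ X, ∀ e, ¬ I.Reaches ((P.errorAut r s).lang κ) d e) {d₀ : I.Dom} (hd₀ : d₀ ∈ X)
    {n : ℕ} (hstart : d₀ ∈ (P.startConcept s n).ext I) : P.Solvable n := by
  have hf : ∀ d : X, ∃ e : X, (d.1, e.1) ∈ I.role r := fun d => by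
    obtain ⟨e, he⟩ := (mem_ext_localConcept.1 (hX d d.2)).1
    exact ⟨⟨e, hXr d d.2 e he⟩, he⟩
  have hg : ∀ d : X, ∃ e : X, (d.1, e.1) ∈ I.role s := fun d => by
    obtain ⟨e, he⟩ := (mem_ext_localConcept.1 (hX d d.2)).2.1
    exact ⟨⟨e, hXs d d.2 e he⟩, he⟩
  have htile : ∀ d : X, ∃ t : Fin k, d.1 ∈ I.concept t := fun d =>
    (mem_ext_localConcept.1 (hX d d.2)).2.2.1
  choose f hf using hf
  choose g hg using hg
  choose tile htile using htile
  let d : ℕ → ℕ → X := fun i j => g^[j] (f^[i] ⟨d₀, hd₀⟩)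
  have hds : ∀ i j, ((d i j).1, (d i (j + 1)).1) ∈ I.role s := by
    intro i j
    have := hg (d i j)
    rwa [show g (d i j) = d i (j + 1) from (Function.iterate_succ_apply' _ _ _).symm] at this
  have hdr : ∀ i, ((d i 0).1, (d (i + 1) 0).1) ∈ I.role r := by
    intro i
    have := hf (d i 0)
    rwa [show f (d i 0) = d (i + 1) 0 from
      (Function.iterate_succ_apply' f i ⟨d₀, hd₀⟩).symm] at this
  have hseg := segment_of_mem_ext (d := fun j => (d 0 j).1) (t := fun j => tile (d 0 j))
    (hds 0) (fun j => htile _) hstart.2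
  refine ⟨fun i j => tile (d i j), fun i j => ?_, fun i j => ?_, ?_, hseg.1, hseg.2⟩
  · exact (mem_ext_localConcept.1 (hX _ (d i j).2)).2.2.2 _ (htile _) _ (hds i j) _ (htile _)
  · by_contra hV
    exact herr _ (d i j).2 _ (reaches_errorAut hr hs hs' (d := fun j => (d i j).1)
      (d' := fun j => (d (i + 1) j).1) (hds i) (hds (i + 1)) (hdr i) (htile _) (htile _) hV)
  · exact mem_ext_only.1 hstart.1 _ (htile _)

end Model

/-! ## From tilings to models -/

/-- The quadrant with the tiles of `τ`; `r` leads to the next row, `s` to the next position in the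
row, and all other roles lead to the origin. -/
def grid (r s : ℕ) (τ : ℕ → ℕ → Fin k) : Interpretation where
  Dom := ℕ × ℕ
  nonempty := ⟨(0, 0)⟩
  indiv _ := (0, 0)
  concept A := {d | (τ d.1 d.2 : ℕ) = A}
  role m := {p | (m = r ∧ p.2 = (p.1.1 + 1, p.1.2)) ∨ (m = s ∧ p.2 = (p.1.1, p.1.2 + 1)) ∨
    (m ≠ r ∧ m ≠ s ∧ p.2 = (0, 0))}

section Grid

variable {n : ℕ} {τ : ℕ → ℕ → Fin k}

theorem mem_grid_concept {d : ℕ × ℕ} {t : Fin k} :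
    d ∈ (grid r s τ).concept t ↔ τ d.1 d.2 = t := Fin.ext_iff.symm

theorem mem_grid_role_fst (hrs : r ≠ s) {d e : ℕ × ℕ} :
    (d, e) ∈ (grid r s τ).role r ↔ e = (d.1 + 1, d.2) := by
  change (r = r ∧ e = (d.1 + 1, d.2)) ∨ (r = s ∧ e = (d.1, d.2 + 1)) ∨
    (r ≠ r ∧ r ≠ s ∧ e = (0, 0)) ↔ _
  simp [hrs]

theorem mem_grid_role_snd (hrs : r ≠ s) {d e : ℕ × ℕ} :
    (d, e) ∈ (grid r s τ).role s ↔ e = (d.1, d.2 + 1) := by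
  change (s = r ∧ e = (d.1 + 1, d.2)) ∨ (s = s ∧ e = (d.1, d.2 + 1)) ∨
    (s ≠ r ∧ s ≠ s ∧ e = (0, 0)) ↔ _
  simp [hrs.symm]

theorem mem_ext_localConcept_grid (hrs : r ≠ s) (hτ : P.Tiles n τ) (d : ℕ × ℕ) :
    d ∈ (P.localConcept r s).ext (grid r s τ) := by
  refine mem_ext_localConcept.2 ⟨⟨_, (mem_grid_role_fst hrs).2 rfl⟩,
    ⟨_, (mem_grid_role_snd hrs).2 rfl⟩, ⟨_, mem_grid_concept.2 rfl⟩, fun t ht e he u hu => ?_⟩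
  obtain rfl := (mem_grid_role_snd hrs).1 he
  rw [← mem_grid_concept.1 ht, ← mem_grid_concept.1 hu]
  exact hτ.horiz _ _

theorem mem_ext_startConcept_grid (hrs : r ≠ s) (hτ : P.Tiles n τ) :
    (0, 0) ∈ (P.startConcept s n).ext (grid r s τ) := by
  have key : ∀ m j, (∀ i < m, P.body (τ 0 (j + i))) → P.last (τ 0 (j + m + 1)) →
      (0, j) ∈ (P.segmentConcept s m).ext (grid r s τ) := by
    intro m
    induction m with
    | zero =>
      intro j _ h
      refine mem_ext_all.2 fun e he => mem_ext_only.2 fun t ht => ?_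
      obtain rfl := (mem_grid_role_snd hrs).1 he
      rw [← mem_grid_concept.1 ht]
      exact h
    | succ m ih =>
      intro j hb h
      refine ⟨mem_ext_only.2 fun t ht => ?_, mem_ext_all.2 fun e he => ?_⟩
      · rw [← mem_grid_concept.1 ht]
        exact hb 0 (by omega)
      · obtain rfl := (mem_grid_role_snd hrs).1 he
        refine ih (j + 1) (fun i hi => ?_) ?_
        · rw [add_assoc, add_comm 1]
          exact hb (i + 1) (by omega)
        · rw [add_assoc j, add_comm 1]
          exact h
  refine ⟨mem_ext_only.2 fun t ht => ?_, key n 0 (by simpa using hτ.body) (by simpa using hτ.last)⟩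
  rw [← mem_grid_concept.1 ht]
  exact hτ.origin

/-- What is known about a position that the error automaton reaches in state `q` with a stack of
height `l`. -/
def Invariant (τ : ℕ → ℕ → Fin k) (q l : ℕ) (d : ℕ × ℕ) : Prop :=
  (q = 0 ∧ l = 0) ∨ q = 3 * (τ d.1 (d.2 + l) : ℕ) + 2 ∨
    (∃ i, d.1 = i + 1 ∧ q = 3 * (τ i (d.2 + l) : ℕ) + 3) ∨
    ∃ i j, d = (i + 1, j + 1) ∧ q = 3 * (τ i j : ℕ) + 4

/-- Position plus stack height is constant while climbing and descending, and an `r`-step at any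
position of the row preserves it. The invariant has no clause for the final state: entering it would
take a diagonal misfit, which the tiling excludes. -/
theorem Invariant.step {κ : RolePartition} (hrs : r ≠ s) (hτ : P.Tiles n τ)
    {x y : (Fin (P.errorAut r s).numStates × List (Fin (P.errorAut r s).numStack)) ×
      (grid r s τ).Dom}
    (h : PathStep κ.kind (P.errorAut r s).toVPA (grid r s τ) x y)
    (hx : Invariant τ x.1.1 x.1.2.length x.2) : Invariant τ y.1.1 y.1.2.length y.2 := by
  classical
  obtain ⟨⟨q, σ⟩, d⟩ := x
  obtain ⟨⟨q', σ'⟩, e⟩ := y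
  obtain ⟨a, hstep, hrel⟩ := h
  dsimp only at hstep hrel hx ⊢
  cases hstep with
  | call _ h =>
    obtain ⟨t, -, h⟩ := List.mem_map.1 h
    simp only [Prod.mk.injEq] at h
    obtain ⟨hq, rfl, hq', -⟩ := h
    obtain rfl := (mem_grid_role_snd hrs).1 hrel
    -- The phases `3 * t + 2`, `3 * t + 3`, `3 * t + 4` differ modulo 3 and all exceed the states
    -- `0` and `1`, so clauses of the wrong phase are arithmetically impossible.
    rcases hx with hx | hx | ⟨i, hi, hx⟩ | ⟨i, j, hd, hx⟩
    · omega
    · refine .inr (.inl ?_)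
      rw [← hq', hq, hx, List.length_cons]
      simp only [add_assoc, add_comm 1]
    · omega
    · omega
  | internal _ h =>
    obtain ⟨t, -, h⟩ := List.mem_flatMap.1 h
    simp only [List.mem_cons, List.mem_map, List.mem_filter, List.mem_finRange, true_and,
      decide_eq_true_eq, Prod.mk.injEq] at h
    rcases h with ⟨hq, rfl, hq'⟩ | ⟨hq, rfl, hq'⟩ | ⟨u, hu, hq, rfl, hq'⟩
    · obtain ⟨rfl, ht⟩ := hrel
      refine .inr (.inl ?_)
      have ht' := mem_grid_concept.1 ht
      rcases hx with ⟨-, hl⟩ | hx | ⟨i, hi, hx⟩ | ⟨i, j, hd, hx⟩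
      · rw [hl, add_zero, ht']
        exact hq'
      · omega
      · omega
      · omega
    · obtain rfl := (mem_grid_role_fst hrs).1 hrel
      rcases hx with hx | hx | ⟨i, hi, hx⟩ | ⟨i, j, hd, hx⟩
      · omega
      · exact .inr (.inr (.inl ⟨_, rfl, by rw [hq']; dsimp only; omega⟩))
      · omega
      · omega
    · obtain ⟨rfl, hu'⟩ := hrel
      have hu' := mem_grid_concept.1 hu'
      rcases hx with hx | hx | ⟨i, hi, hx⟩ | ⟨i, j, hd, hx⟩
      · omega
      · omega
      · omega
      · have ht : t = τ i j := Fin.ext (by omega)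
        subst ht hu' hd
        exact absurd (hτ.diag i j) hu
  | ret _ h =>
    obtain ⟨t, -, h⟩ := List.mem_flatMap.1 h
    simp only [List.mem_cons, List.not_mem_nil, or_false, Prod.mk.injEq] at h
    rcases h with ⟨hq, rfl, -, hq'⟩ | ⟨-, -, ho, -⟩
    swap
    · exact absurd ho (Option.some_ne_none _)
    obtain rfl := (mem_grid_role_snd hrs).1 hrel
    rw [List.length_cons] at hx
    rcases hx with hx | hx | ⟨i, hi, hx⟩ | ⟨i, j, hd, hx⟩
    · omega
    · omega
    · refine .inr (.inr (.inl ⟨i, hi, ?_⟩))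
      rw [hq', ← hq, hx]
      simp only [add_assoc, add_comm 1]
    · omega
  | retBottom _ h =>
    obtain ⟨t, -, h⟩ := List.mem_flatMap.1 h
    simp only [List.mem_cons, List.not_mem_nil, or_false, Prod.mk.injEq] at h
    rcases h with ⟨-, -, ho, -⟩ | ⟨hq, rfl, -, hq'⟩
    · exact absurd ho.symm (Option.some_ne_none _)
    obtain rfl := (mem_grid_role_snd hrs).1 hrel
    rcases hx with hx | hx | ⟨i, hi, hx⟩ | ⟨i, j, hd, hx⟩
    · omega
    · omega
    · refine .inr (.inr (.inr ⟨i, d.2, by rw [← hi], ?_⟩))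
      rw [List.length_nil, add_zero] at hx
      omega
    · omega

theorem not_reaches_errorAut_grid {κ : RolePartition} (hrs : r ≠ s) (hτ : P.Tiles n τ)
    (d e : ℕ × ℕ) : ¬ (grid r s τ).Reaches ((P.errorAut r s).lang κ) d e := by
  intro h
  obtain ⟨q₀, h₀, q, hq, σ, h⟩ := reaches_lang_iff.1 h
  have h₀ : (q₀ : ℕ) = 0 := List.mem_singleton.1 h₀
  have hq : (q : ℕ) = 1 := List.mem_singleton.1 hq
  have key : ∀ y, Relation.ReflTransGen (PathStep κ.kind (P.errorAut r s).toVPA (grid r s τ))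
      ((q₀, []), d) y → Invariant τ y.1.1 y.1.2.length y.2 := by
    intro y hy
    induction hy with
    | refl => exact .inl ⟨h₀, rfl⟩
    | tail _ h ih => exact ih.step hrs hτ h
  rcases key _ h with hx | hx | ⟨i, hi, hx⟩ | ⟨i, j, -, hx⟩ <;> dsimp only at hx <;> omega

end Grid

end TileSystem

/-! ## Computability of the constructors -/

/-- On Gödel numbers the constructors are arithmetic expressions, here and below. -/
theorem Concept.primrec_neg : Primrec Concept.neg := by
  rw [← Primrec.encode_iff]
  exact Primrec.nat_add.comp (Primrec.nat_mul.comp (Primrec.const 4) Primrec.encode)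
    (Primrec.const 2)

theorem Concept.primrec_inter (C : Concept) : Primrec (Concept.inter C) := by
  rw [← Primrec.encode_iff]
  exact Primrec.nat_add.comp (Primrec.nat_mul.comp (Primrec.const 4)
    (Primrec₂.natPair.comp (Primrec.const C.toNat) Primrec.encode)) (Primrec.const 3)

theorem Concept.primrec_ex (r : ℕ) : Primrec (Concept.ex r) := by
  rw [← Primrec.encode_iff]
  exact Primrec.nat_add.comp (Primrec.nat_mul.comp (Primrec.const 4)
    (Primrec₂.natPair.comp (Primrec.const r) Primrec.encode)) (Primrec.const 4)

namespace VplConcept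

theorem primrec_neg : Primrec neg := by
  rw [← Primrec.encode_iff]
  exact Primrec.nat_add.comp (Primrec.nat_mul.comp (Primrec.const 5) Primrec.encode)
    (Primrec.const 2)

theorem primrec_inter : Primrec₂ inter := by
  refine Primrec.encode_iff.1 ?_
  exact Primrec.nat_add.comp (Primrec.nat_mul.comp (Primrec.const 5)
    (Primrec₂.natPair.comp (Primrec.encode.comp Primrec.fst) (Primrec.encode.comp Primrec.snd)))
    (Primrec.const 3)

theorem primrec_ex (R : Role) : Primrec (ex R) := by
  rw [← Primrec.encode_iff]
  exact Primrec.nat_add.comp (Primrec.nat_mul.comp (Primrec.const 5)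
    (Primrec₂.natPair.comp (Primrec.const (Encodable.encode R)) Primrec.encode)) (Primrec.const 4)

end VplConcept

/-! ### Embedding of ALC-concepts into the larger language -/

namespace Concept

/-- An ALC-concept as a concept of the larger language. -/
def toVpl : Concept → VplConcept
  | top => .top
  | name A => .name A
  | neg C => .neg C.toVpl
  | inter C D => .inter C.toVpl D.toVpl
  | ex r C => .ex (.name r) C.toVpl

theorem ext_toVpl (κ : RolePartition) (I : Interpretation) (C : Concept) :
    C.toVpl.ext κ I = C.ext I := by
  induction C with
  | top => rfl
  | name A => rfl
  | neg C ih => rw [toVpl, VplConcept.ext, ih, ext]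
  | inter C D ihC ihD => rw [toVpl, VplConcept.ext, ihC, ihD, ext]
  | ex r C ih => rw [toVpl, VplConcept.ext, ih]; rfl

end Concept

namespace TileSystem

open TwoWayVPQ.Concept

variable {k : ℕ} (P : TileSystem (Fin k)) (r s : ℕ)

theorem primrec_startConcept : Primrec (P.startConcept s) := by
  have hseg : Primrec (P.segmentConcept s) := by
    refine (Primrec.nat_rec₁ (all s (only P.last))
      (f := fun _ C => inter (only P.body) (all s C)) ?_).of_eq fun n => ?_
    · exact ((primrec_inter _).comp (primrec_neg.comp ((primrec_ex s).comp
        (primrec_neg.comp Primrec.snd)))).to₂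
    · induction n with
      | zero => rfl
      | succ n ih => rw [segmentConcept, ← ih]
  exact (primrec_inter _).comp hseg

/-- Direct recursion on `n` avoids the computability of `toVpl` on arbitrary concepts. -/
theorem primrec_toVpl_startConcept : Primrec fun n => (P.startConcept s n).toVpl := by
  have hseg : Primrec fun n => (P.segmentConcept s n).toVpl := by
    refine (Primrec.nat_rec₁ (all s (only P.last)).toVpl
      (f := fun _ C => .inter (only P.body).toVpl (.neg (.ex (.name s) (.neg C)))) ?_).of_eq
      fun n => ?_
    · exact (VplConcept.primrec_inter.comp (Primrec.const _) (VplConcept.primrec_neg.comp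
        ((VplConcept.primrec_ex _).comp (VplConcept.primrec_neg.comp Primrec.snd)))).to₂
    · induction n with
      | zero => rfl
      | succ n ih => simp only [segmentConcept, toVpl, all, ← ih]
  exact VplConcept.primrec_inter.comp (Primrec.const _) hseg

/-! ## The reductions -/

/-- Everywhere the local conditions hold, and some element starts a tiling. -/
noncomputable def tbox (n : ℕ) : TBox :=
  [(top, ex (r + s + 1) (P.startConcept s n)), (top, P.localConcept r s)]

/-- Some tiles do not fit diagonally. -/
noncomputable def errorQuery : Query := ⟨P.errorAut r s, 0, 1⟩

/-- The automaton for all words over `r` and `s`. -/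
def walkAut : VPADesc where
  numStates := 1
  numStack := 0
  initial := [0]
  final := [0]
  callTrans := []
  intTrans := [(0, .role (.name r), 0)]
  retTrans := [(0, .role (.name s), none, 0)]

/-- The local conditions hold everywhere and no tiles fail to fit diagonally. -/
noncomputable def globalConcept : VplConcept :=
  .neg (.exLang (walkAut r s) (.neg (.inter (P.localConcept r s).toVpl
    (.neg (.exLang (P.errorAut r s) .top)))))

/-- The start of a tiling. -/
noncomputable def tilingConcept (n : ℕ) : VplConcept :=
  .inter (P.startConcept s n).toVpl (P.globalConcept r s)

theorem computable_tbox_query : Computable fun n => (P.tbox r s n, P.errorQuery r s) := by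
  refine Computable.pair ?_ (Computable.const _)
  exact (Primrec.list_cons.comp (Primrec.pair (Primrec.const top)
    ((primrec_ex _).comp (P.primrec_startConcept s))) (Primrec.const _)).to_comp

theorem computable_tilingConcept : Computable (P.tilingConcept r s) :=
  (VplConcept.primrec_inter.comp (P.primrec_toVpl_startConcept s) (Primrec.const _)).to_comp

variable {P r s} {κ : RolePartition}

/-- A TBox treats all elements alike and cannot name an origin; a successor along a third role
provides one. -/
theorem entails_iff (hr : κ (.name r) = .internal) (hs : κ (.name s) = .ret)
    (hs' : κ (.inv s) = .call) (n : ℕ) :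
    Entails κ (P.tbox r s n) (P.errorQuery r s) ↔ ¬ P.Solvable n := by
  have hrs : r ≠ s := by
    rintro rfl
    rw [hr] at hs
    cases hs
  constructor
  · rintro h ⟨τ, hτ⟩
    obtain ⟨η, hη⟩ := h (grid r s τ) (by
      intro g hg
      simp only [tbox, List.mem_cons, List.not_mem_nil, or_false] at hg
      rcases hg with rfl | rfl
      · exact fun d _ => ⟨(0, 0), mem_ext_startConcept_grid hrs hτ,
          .inr (.inr ⟨by omega, by omega, rfl⟩)⟩
      · exact fun d _ => mem_ext_localConcept_grid hrs hτ d)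
    exact not_reaches_errorAut_grid hrs hτ _ _ hη
  · intro h I hI
    by_contra hq
    obtain ⟨d⟩ := I.nonempty
    obtain ⟨d₀, hd₀, -⟩ := hI (top, ex (r + s + 1) (P.startConcept s n)) (by simp [tbox])
      (Set.mem_univ d)
    refine h (solvable_of_model hr hs hs' Set.univ (fun d hd => ?_) (fun _ _ _ _ => trivial)
      (fun _ _ _ _ => trivial) (fun d _ e he => ?_) (Set.mem_univ d₀) hd₀)
    · exact hI (top, P.localConcept r s) (by simp [tbox]) (Set.mem_univ d)
    · exact hq ⟨fun m => if m = 0 then d else e, he⟩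

/-- Without stack symbols the stack stays empty, and a return letter may read the bottom symbol any
number of times. -/
theorem walkAut_tail (hr : κ (.name r) = .internal) (hs : κ (.name s) = .ret)
    {I : Interpretation} {d e e' : I.Dom} (h : I.Reaches ((walkAut r s).lang κ) d e)
    (he : (e, e') ∈ I.role r ∨ (e, e') ∈ I.role s) :
    I.Reaches ((walkAut r s).lang κ) d e' := by
  obtain ⟨q₀, h₀, q, hq, σ, h⟩ := reaches_lang_iff.1 h
  refine reaches_lang_iff.2 ⟨q₀, h₀, q, hq, σ, h.tail ?_⟩
  have hq : (q : ℕ) = 0 := List.mem_singleton.1 hq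
  cases σ with
  | cons z => exact Fin.elim0 z
  | nil =>
    rcases he with he | he
    · refine ⟨.role (.name r), .internal hr ?_, he⟩
      change ((q : ℕ), _, (q : ℕ)) ∈ [_]
      rw [hq]
      exact List.mem_singleton.2 rfl
    · refine ⟨.role (.name s), .retBottom hs ?_, he⟩
      change ((q : ℕ), _, _, (q : ℕ)) ∈ [_]
      rw [hq]
      exact List.mem_singleton.2 rfl

theorem satisfiable_iff (hr : κ (.name r) = .internal) (hs : κ (.name s) = .ret)
    (hs' : κ (.inv s) = .call) (n : ℕ) :
    (P.tilingConcept r s n).Satisfiable κ ↔ P.Solvable n := by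
  have hrs : r ≠ s := by
    rintro rfl
    rw [hr] at hs
    cases hs
  constructor
  · rintro ⟨I, d₀, hstart, hglobal⟩
    rw [ext_toVpl] at hstart
    have hX : ∀ d, I.Reaches ((walkAut r s).lang κ) d₀ d →
        d ∈ (P.localConcept r s).ext I ∧ ∀ e, ¬ I.Reaches ((P.errorAut r s).lang κ) d e := by
      intro d hd
      have : d ∈ (VplConcept.inter (P.localConcept r s).toVpl
          (.neg (.exLang (P.errorAut r s) .top))).ext κ I :=
        by_contra fun h => hglobal ⟨d, h, hd⟩
      refine ⟨?_, fun e he => this.2 ⟨e, Set.mem_univ e, he⟩⟩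
      rw [← ext_toVpl κ]
      exact this.1
    refine solvable_of_model hr hs hs' {d | I.Reaches ((walkAut r s).lang κ) d₀ d}
      (fun d hd => (hX d hd).1) (fun d hd e he => walkAut_tail hr hs hd (.inl he))
      (fun d hd e he => walkAut_tail hr hs hd (.inr he)) (fun d hd => (hX d hd).2) ?_ hstart
    let q : Fin (walkAut r s).numStates := ⟨0, Nat.one_pos⟩
    exact reaches_lang_iff.2 ⟨q, List.mem_singleton.2 rfl, q, List.mem_singleton.2 rfl, [], .refl⟩
  · rintro ⟨τ, hτ⟩
    refine ⟨grid r s τ, (0, 0), ?_, ?_⟩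
    · rw [ext_toVpl]
      exact mem_ext_startConcept_grid hrs hτ
    · rintro ⟨d, hd, -⟩
      refine hd ⟨?_, ?_⟩
      · rw [ext_toVpl]
        exact mem_ext_localConcept_grid hrs hτ d
      · rintro ⟨e, -, he⟩
        exact not_reaches_errorAut_grid hrs hτ _ _ he

end TileSystem

/-! ### Undecidability for fixed partitions and for partitions in the input -/

/-- The map `f` covers both versions: the identity for a fixed partition, and pairing with a
constant suitable partition when it is part of the input. -/
theorem not_computablePred_entails_comp {κ : RolePartition} (hκ : κ.Suitable) {α : Type}
    [Primcodable α] (p : α → Prop) (f : TBox × Query → α) (hf : Computable f)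
    (hp : ∀ i, p (f i) ↔ Entails κ i.1 i.2) : ¬ ComputablePred p := by
  obtain ⟨r, s, hs, hs', hr⟩ := hκ
  obtain ⟨k, P, hP⟩ := StackMachine.exists_tileSystem_undecidable
  intro h
  have h' := (ComputablePred.computable_of_manyOneReducible (p := fun n => ¬ P.Solvable n)
    ⟨_, hf.comp (P.computable_tbox_query r s), fun n => ?_⟩ h).not
  · exact hP (h'.of_eq fun n => not_not)
  · rw [hp, TileSystem.entails_iff hr hs hs']

theorem not_computablePred_satisfiable_comp {κ : RolePartition} (hκ : κ.Suitable) {α : Type}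
    [Primcodable α] (p : α → Prop) (f : VplConcept → α) (hf : Computable f)
    (hp : ∀ C, p (f C) ↔ C.Satisfiable κ) : ¬ ComputablePred p := by
  obtain ⟨r, s, hs, hs', hr⟩ := hκ
  obtain ⟨k, P, hP⟩ := StackMachine.exists_tileSystem_undecidable
  intro h
  refine hP (ComputablePred.computable_of_manyOneReducible
    ⟨_, hf.comp (P.computable_tilingConcept r s), fun n => ?_⟩ h)
  rw [hp, TileSystem.satisfiable_iff hr hs hs']

theorem suitable_ofLists : (RolePartition.ofLists ([.inv 1], [.name 1])).Suitable :=
  ⟨0, 1, rfl, rfl, rfl⟩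

end TwoWayVPQ

theorem mainTheorem4 :
    -- entailment of two-way VPQs over ALC-TBoxes, the partition being part of the input
    (¬ ComputablePred fun i : (List TwoWayVPQ.Role × List TwoWayVPQ.Role) ×
        TwoWayVPQ.TBox × TwoWayVPQ.Query =>
      TwoWayVPQ.Entails (TwoWayVPQ.RolePartition.ofLists i.1) i.2.1 i.2.2) ∧
    -- the same problem for any fixed partition with a suitable pair of role names
    (∀ κ : TwoWayVPQ.RolePartition, κ.Suitable →
      ¬ ComputablePred fun i : TwoWayVPQ.TBox × TwoWayVPQ.Query =>
        TwoWayVPQ.Entails κ i.1 i.2) ∧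
    -- concept satisfiability for ALC_vpl with inverses, in the same two versions
    (¬ ComputablePred fun i : (List TwoWayVPQ.Role × List TwoWayVPQ.Role) ×
        TwoWayVPQ.VplConcept =>
      i.2.Satisfiable (TwoWayVPQ.RolePartition.ofLists i.1)) ∧
    (∀ κ : TwoWayVPQ.RolePartition, κ.Suitable →
      ¬ ComputablePred fun C : TwoWayVPQ.VplConcept => C.Satisfiable κ) :=
  ⟨TwoWayVPQ.not_computablePred_entails_comp TwoWayVPQ.suitable_ofLists _ _
      ((Computable.const _).pair Computable.id) fun _ => Iff.rfl,
    fun _ hκ => TwoWayVPQ.not_computablePred_entails_comp hκ _ _ Computable.id fun _ => Iff.rfl,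
    TwoWayVPQ.not_computablePred_satisfiable_comp TwoWayVPQ.suitable_ofLists _ _
      ((Computable.const _).pair Computable.id) fun _ => Iff.rfl,
    fun _ hκ => TwoWayVPQ.not_computablePred_satisfiable_comp hκ _ _ Computable.id fun _ => Iff.rfl⟩
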